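/- Let $X$ be a separable infinite-dimensional complex Banach space and let $\mathcal B(X)$ be the space of bounded linear operators on $X$ with the operator norm. An operator $B\in\mathcal B(X)$ is called a generalised backward $1$-shift if there are linearly independent vectors $x_1,x_2,\dots$ in $X$ whose linear span is dense in $X$ and scalars $a^k_i\in\mathbb C$ ($1\le i<k$) such that $Bx_k=\sum_{i=1}^{k-1}a^k_i x_i$ for every $k\ge 1$ (so $Bx_1=0$) and $a^k_{k-1}\ne 0$ for every $k\ge 2$. An operator $T\in\mathcal B(X)$ is called mixing if for every pair of nonempty open sets $U,V\subseteq X$ there is $N$ such that $T^n(U)\cap V\neq\emptyset$ for all $n>N$. Let $S\in\mathcal B(X)$ be such that its generalised kernel $\bigcup_{n=1}^\infty\ker(S^n)$ is dense in $X$. Then $S$ lies in the operator-norm closure of the set of generalised backward $1$-shifts on $X$, and for every $\lambda\in\mathbb C$ with $|\lambda|=1$ the operator $\lambda I+S$ lies in the operator-norm closure of the set of mixing operators on $X$. -/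

import Mathlib

/-- The generalised kernel `⋃_{n ≥ 1} ker (T ^ n)` of a bounded operator. -/
def generalisedKernel {X : Type*} [NormedAddCommGroup X] [NormedSpace ℂ X]
    (T : X →L[ℂ] X) : Set X :=
  ⋃ n : ℕ, ⋃ _ : 1 ≤ n, {x : X | (T ^ n) x = 0}

/-- `T` is mixing: for all nonempty open `U, V` there is `N` such that `T ^ n (U)` meets `V`
for every `n > N`. -/
def IsMixingOperator {X : Type*} [NormedAddCommGroup X] [NormedSpace ℂ X]
    (T : X →L[ℂ] X) : Prop :=
  ∀ U V : Set X, IsOpen U → IsOpen V → U.Nonempty → V.Nonempty →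
    ∃ N : ℕ, ∀ n : ℕ, N < n → (((T ^ n) '' U) ∩ V).Nonempty

/-- `S` is a generalised backward shift adapted to the doubly indexed family `x`, whose chains
are indexed by a linear order `ι` and whose positions in a chain are indexed by `ℕ`
(starting from `0`). The family is linearly independent with dense span, and each `S (x (l, k))`
is a finite linear combination (with coefficients `c`) of vectors whose index is
lexicographically smaller than `(l, k)`, the coefficient of the immediate predecessor
`x (l, k - 1)` being nonzero unless `x (l, k)` is the first vector of its chain. -/
structure IsGeneralisedBackwardShiftAdapted {X : Type*} [NormedAddCommGroup X] [NormedSpace ℂ X]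
    {ι : Type*} [LinearOrder ι] (S : X →L[ℂ] X) (x : ι × ℕ → X) : Prop where
  linearIndependent : LinearIndependent ℂ x
  dense_span : Dense (Submodule.span ℂ (Set.range x) : Set X)
  shift : ∀ (l : ι) (k : ℕ), ∃ c : ι × ℕ →₀ ℂ,
    S (x (l, k)) = Finsupp.linearCombination ℂ x c ∧
    (∀ i ∈ c.support, toLex i < toLex (l, k)) ∧
    (0 < k → c (l, k - 1) ≠ 0)

/-- `S` is a generalised backward `n`-shift: it is adapted to some family with `n` chains. -/
def IsGeneralisedBackwardShift {X : Type*} [NormedAddCommGroup X] [NormedSpace ℂ X]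
    (n : ℕ) (S : X →L[ℂ] X) : Prop :=
  ∃ x : Fin n × ℕ → X, IsGeneralisedBackwardShiftAdapted S x

/-! A dense generalised kernel makes `S` strictly upper triangular on some independent sequence `e`
with dense span. A small series of rank-one operators repairs the zero superdiagonal entries, giving
a backward shift `B` near `S`.

It remains to see that `z • 1 + B` is mixing. Up to rotation it is `1 + T` with `T = z⁻¹ • B`. If `T
^ N` kills `u`, the Newton vectors of polynomials of degree below `N` satisfy `(1 + T) ^ k` (vector
of `f` at 0) = (vector of `f` at `k`), so `1 + T` acts as translation on polynomials. With `N = 2 *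
n`, degree suffices for a polynomial close to a given `q` of degree below `n` near 0 and close to 0
near `k`, or the reverse. For binomial `q` the vector at 0 is `T ^ n u`. Each `e m` has this form,
since `B` maps each initial span onto the previous one. -/

open Set Filter Topology

/-! ### Linear algebra of triangular sequences -/

/-- A family indexed by `ℕ` none of whose members is in the span of its predecessors is linearly
independent. -/
theorem linearIndependent_of_notMem_span_Iio {K V : Type*} [Field K] [AddCommGroup V] [Module K V]
    {e : ℕ → V} (he : ∀ k, e k ∉ Submodule.span K (e '' Iio k)) : LinearIndependent K e := by
  rw [linearIndependent_iff]
  intro l hl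
  by_contra hne
  have hs : l.support.Nonempty := Finsupp.support_nonempty_iff.2 hne
  set m := l.support.max' hs with hm
  have hmem : m ∈ l.support := l.support.max'_mem hs
  have hlm : l m ≠ 0 := Finsupp.mem_support_iff.1 hmem
  apply he m
  rw [Finsupp.linearCombination_apply, Finsupp.sum, ← Finset.add_sum_erase _ _ hmem] at hl
  have h1 : l m • e m ∈ Submodule.span K (e '' Iio m) := by
    rw [eq_neg_of_add_eq_zero_left hl]
    refine Submodule.neg_mem _ (Submodule.sum_mem _ fun i hi => Submodule.smul_mem _ _ ?_)
    refine Submodule.subset_span ⟨i, ?_, rfl⟩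
    exact lt_of_le_of_ne (l.support.le_max' i (Finset.mem_of_mem_erase hi))
      (Finset.ne_of_mem_erase hi)
  exact (Submodule.smul_mem_iff _ hlm).1 h1

/-- Deleting from a sequence the members that depend linearly on their predecessors. -/
theorem exists_strictMono_linearIndependent_comp {K V : Type*} [Field K] [AddCommGroup V]
    [Module K V] (w : ℕ → V) (hw : ¬ FiniteDimensional K (Submodule.span K (range w))) :
    ∃ φ : ℕ → ℕ, StrictMono φ ∧ LinearIndependent K (w ∘ φ) ∧
      Submodule.span K (range (w ∘ φ)) = Submodule.span K (range w) ∧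
      ∀ k, Submodule.span K (w '' Iio (φ k)) ≤ Submodule.span K ((w ∘ φ) '' Iio k) := by
  classical
  set I : Set ℕ := {k | w k ∉ Submodule.span K (w '' Iio k)} with hI
  -- The bound `Iic k` is what lets triangularity survive the deletion: initial segments keep their
  -- spans.
  have key : ∀ k, w k ∈ Submodule.span K (w '' (I ∩ Iic k)) := by
    intro k
    induction k using Nat.strong_induction_on with
    | _ k ih =>
      by_cases hk : k ∈ I
      · exact Submodule.subset_span ⟨k, ⟨hk, le_refl k⟩, rfl⟩
      · have hk' : w k ∈ Submodule.span K (w '' Iio k) := by simpa [hI] using hk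
        refine Submodule.span_le.2 ?_ hk'
        rintro _ ⟨i, hi, rfl⟩
        exact Submodule.span_mono (image_mono (inter_subset_inter_right _
          (Iic_subset_Iic.2 (le_of_lt hi)))) (ih i hi)
  have hspan : Submodule.span K (w '' I) = Submodule.span K (range w) := by
    refine le_antisymm (Submodule.span_mono (image_subset_range _ _)) (Submodule.span_le.2 ?_)
    rintro _ ⟨k, rfl⟩
    exact Submodule.span_mono (image_mono inter_subset_left) (key k)
  have hinf : I.Infinite := by
    intro hfin
    apply hw
    rw [← hspan]
    exact FiniteDimensional.span_of_finite K (hfin.image w)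
  have hinf' : (Set.ofPred fun k => k ∈ I).Infinite := hinf
  set φ := Nat.nth (fun k => k ∈ I) with hφ
  have hmono : StrictMono φ := Nat.nth_strictMono hinf'
  have hmem : ∀ k, φ k ∈ I := Nat.nth_mem_of_infinite hinf'
  have hrange : range φ = I := Nat.range_nth_of_infinite hinf'
  have himg : ∀ k, (w ∘ φ) '' Iio k ⊆ w '' Iio (φ k) := by
    rintro k _ ⟨i, hi, rfl⟩
    exact ⟨φ i, hmono hi, rfl⟩
  refine ⟨φ, hmono, ?_, ?_, ?_⟩
  · exact linearIndependent_of_notMem_span_Iio fun k hk =>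
      hmem k (Submodule.span_mono (himg k) hk)
  · rw [range_comp, hrange, hspan]
  · intro k
    refine Submodule.span_le.2 ?_
    rintro _ ⟨i, hi, rfl⟩
    refine Submodule.span_mono ?_ (key i)
    rintro _ ⟨j, ⟨hjI, hji⟩, rfl⟩
    rw [← hrange] at hjI
    obtain ⟨a, rfl⟩ := hjI
    exact ⟨a, hmono.lt_iff_lt.1 (lt_of_le_of_lt hji hi), rfl⟩

/-! ### Triangular form and perturbation to a backward shift -/

section NormedSpace

variable {X : Type*} [NormedAddCommGroup X] [NormedSpace ℂ X]

/-- An operator with dense generalised kernel is strictly upper triangular with respect to some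
linearly independent sequence with dense span. -/
theorem exists_triangular_of_dense_generalisedKernel [TopologicalSpace.SeparableSpace X]
    (hX : ¬ FiniteDimensional ℂ X) (S : X →L[ℂ] X) (hS : Dense (generalisedKernel S)) :
    ∃ e : ℕ → X, LinearIndependent ℂ e ∧ Dense (Submodule.span ℂ (range e) : Set X) ∧
      ∀ k, S (e k) ∈ Submodule.span ℂ (e '' Iio k) := by
  have hne : (generalisedKernel S).Nonempty := ⟨0, by
    simp only [generalisedKernel, mem_iUnion]; exact ⟨1, le_rfl, map_zero _⟩⟩
  have : Nonempty (generalisedKernel S) := hne.to_subtype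
  have : SecondCountableTopology X := UniformSpace.secondCountable_of_separable X
  set v : ℕ → X := fun j => (TopologicalSpace.denseSeq (generalisedKernel S) j : X) with hv
  have hvd : DenseRange v :=
    (hS.denseRange_val).comp (TopologicalSpace.denseRange_denseSeq _) continuous_subtype_val
  have hvk : ∀ j, ∃ n, 1 ≤ n ∧ (S ^ n) (v j) = 0 := by
    intro j
    have := (TopologicalSpace.denseSeq (generalisedKernel S) j).2
    obtain ⟨n, hn⟩ := mem_iUnion.1 this
    obtain ⟨h1, hn⟩ := mem_iUnion.1 hn
    exact ⟨n, h1, hn⟩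
  choose d hd1 hd using hvk
  -- Each orbit is listed backwards, from `S ^ d v = 0` up to `v`. For `i > d` truncated subtraction
  -- merely repeats `v`, whose image stands at position `d - 1`.
  set w : ℕ → X := fun k => (S ^ (d k.unpair.1 - k.unpair.2)) (v k.unpair.1) with hw
  have hwp : ∀ j i, w (Nat.pair j i) = (S ^ (d j - i)) (v j) := by
    intro j i; simp [hw]
  have hstep : ∀ k, S (w k) ∈ Submodule.span ℂ (w '' Iio k) := by
    intro k
    obtain ⟨j, i, rfl⟩ : ∃ j i, k = Nat.pair j i := ⟨_, _, (Nat.pair_unpair k).symm⟩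
    have hSw : S (w (Nat.pair j i)) = (S ^ (d j - i + 1)) (v j) := by
      rw [hwp, pow_succ']; rfl
    rw [hSw]
    rcases Nat.eq_zero_or_pos i with rfl | hi
    · rw [Nat.sub_zero, pow_succ']
      simp [hd]
    · have hdj := hd1 j
      refine Submodule.subset_span ⟨Nat.pair j (d j - (d j - i + 1)), ?_, ?_⟩
      · exact Nat.pair_lt_pair_right j (by omega)
      · rw [hwp]
        congr 2
        omega
  have hvw : range v ⊆ Submodule.span ℂ (range w) := by
    rintro _ ⟨j, rfl⟩
    refine Submodule.subset_span ⟨Nat.pair j (d j), ?_⟩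
    rw [hwp]; simp
  have hdense : Dense (Submodule.span ℂ (range w) : Set X) := Dense.mono hvw hvd
  obtain ⟨φ, -, hli, hsp, hφ⟩ := exists_strictMono_linearIndependent_comp (K := ℂ) w (by
    intro hfin
    have hcl : IsClosed (Submodule.span ℂ (range w) : Set X) :=
      Submodule.closed_of_finiteDimensional _
    have htop : Submodule.span ℂ (range w) = ⊤ := by
      rw [← SetLike.coe_set_eq, Submodule.top_coe, ← hcl.closure_eq]
      exact hdense.closure_eq
    rw [htop] at hfin
    exact hX (Module.finite_def.2 (Module.Finite.iff_fg.1 hfin)))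
  exact ⟨w ∘ φ, hli, by rwa [hsp], fun k => hφ k (hstep (φ k))⟩

/-- A vector outside a finite-dimensional subspace is separated from it by a functional. -/
theorem Submodule.exists_strongDual_eq_one_of_notMem (E : Submodule ℂ X) [FiniteDimensional ℂ E]
    {x : X} (hx : x ∉ E) : ∃ f : StrongDual ℂ X, f x = 1 ∧ ∀ y ∈ E, f y = 0 := by
  have : IsClosed (E : Set X) := E.closed_of_finiteDimensional
  have hx' : E.mkQL x ≠ 0 := by
    simpa [Submodule.Quotient.mk_eq_zero] using hx
  obtain ⟨g, hg⟩ := SeparatingDual.exists_eq_one (R := ℂ) hx'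
  refine ⟨g.comp E.mkQL, hg, fun y hy => ?_⟩
  have : E.mkQL y = 0 := by simpa [Submodule.Quotient.mk_eq_zero] using hy
  simp [this]

/-- A strictly upper triangular operator becomes a generalised backward `1`-shift after an
arbitrarily small perturbation of its superdiagonal. -/
theorem exists_near_shift_of_triangular [CompleteSpace X] (S : X →L[ℂ] X) {e : ℕ → X}
    (hli : LinearIndependent ℂ e) (hS : ∀ k, S (e k) ∈ Submodule.span ℂ (e '' Iio k))
    {ε : ℝ} (hε : 0 < ε) :
    ∃ B : X →L[ℂ] X, dist S B < ε ∧ ∀ m, ∃ c : ℕ →₀ ℂ,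
      B (e m) = Finsupp.linearCombination ℂ e c ∧ (∀ i ∈ c.support, i < m) ∧
      (0 < m → c (m - 1) ≠ 0) := by
  classical
  have hf : ∀ k, ∃ f : StrongDual ℂ X, f (e k) = 1 ∧ ∀ i < k, f (e i) = 0 := by
    intro k
    have : FiniteDimensional ℂ (Submodule.span ℂ (e '' Iio k)) :=
      FiniteDimensional.span_of_finite ℂ ((finite_Iio k).image e)
    obtain ⟨f, h1, h0⟩ := Submodule.exists_strongDual_eq_one_of_notMem
      (Submodule.span ℂ (e '' Iio k)) (x := e k)
      (hli.notMem_span_image (by simp))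
    exact ⟨f, h1, fun i hi => h0 _ (Submodule.subset_span ⟨i, hi, rfl⟩)⟩
  choose f hf1 hf0 using hf
  have ha : ∀ k, ∃ a : ℕ →₀ ℂ, S (e k) = Finsupp.linearCombination ℂ e a ∧
      ∀ i ∈ a.support, i < k := by
    intro k
    obtain ⟨a, ha, h⟩ := (Finsupp.mem_span_image_iff_linearCombination ℂ).1 (hS k)
    exact ⟨a, h.symm, fun i hi => (Finsupp.mem_supported ℂ a).1 ha hi⟩
  choose a hSa hasupp using ha
  -- Since `f (k + 1)` kills `e 0, …, e k`, only the terms with `k < m` act on `e m`, and term `k`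
  -- contributes a multiple of `e k`: triangularity is kept.
  set R : ℕ → X →L[ℂ] X := fun k => (f (k + 1)).smulRight (e k) with hR
  -- The norms of the corrections sum to at most `ε / 2`.
  set η : ℕ → ℝ := fun k => ε / 4 * (1 / 2) ^ k / (1 + ‖R k‖) with hη
  have hη0 : ∀ k, 0 < η k := fun k => by simp only [hη]; positivity
  set δ : ℕ → ℂ := fun k => if a (k + 1) k = 0 then (η k : ℂ) else 0 with hδ
  have hδa : ∀ k, a (k + 1) k + δ k ≠ 0 := by
    intro k
    by_cases h : a (k + 1) k = 0
    · simp [hδ, h, (hη0 k).ne']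
    · simp [hδ, h]
  have hbound : ∀ k, ‖δ k • R k‖ ≤ ε / 4 * (1 / 2) ^ k := by
    intro k
    have h1 : ‖δ k‖ ≤ η k := by
      by_cases h : a (k + 1) k = 0
      · simp [hδ, h, abs_of_pos (hη0 k)]
      · simpa [hδ, h] using (hη0 k).le
    rw [norm_smul]
    calc ‖δ k‖ * ‖R k‖ ≤ η k * (1 + ‖R k‖) := by
          gcongr
          linarith
      _ = ε / 4 * (1 / 2) ^ k := by
          simp only [hη]
          have : (1 + ‖R k‖) ≠ 0 := by positivity
          field_simp
  have hgeo : HasSum (fun k : ℕ => ε / 4 * (1 / 2 : ℝ) ^ k) (ε / 4 * 2) :=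
    hasSum_geometric_two.mul_left _
  have hsum : Summable fun k => δ k • R k := Summable.of_norm_bounded hgeo.summable hbound
  refine ⟨S + ∑' k, δ k • R k, ?_, fun m => ?_⟩
  · rw [dist_eq_norm, sub_add_cancel_left, norm_neg]
    have := tsum_of_norm_bounded hgeo hbound
    linarith
  · refine ⟨a m + ∑ k ∈ Finset.range m, Finsupp.single k (δ k * f (k + 1) (e m)), ?_, ?_, ?_⟩
    · have h1 : (∑' k, δ k • R k) (e m) = ∑' k, (δ k • R k) (e m) :=
        ContinuousLinearMap.map_tsum (ContinuousLinearMap.apply ℂ X (e m)) hsum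
      have h2 : ∑' k, (δ k • R k) (e m) = ∑ k ∈ Finset.range m, (δ k • R k) (e m) := by
        refine tsum_eq_sum fun k hk => ?_
        have : f (k + 1) (e m) = 0 := hf0 (k + 1) m (by
          have := Finset.mem_range.not.1 hk; omega)
        simp [hR, this]
      rw [add_apply, h1, h2, map_add, ← hSa, map_sum]
      simp only [hR, Finsupp.linearCombination_single, mul_smul]
      rfl
    · intro i hi
      by_contra hmi
      rw [Finsupp.mem_support_iff] at hi
      apply hi
      have h1 : a m i = 0 := by
        by_contra h
        exact hmi (hasupp m i (Finsupp.mem_support_iff.2 h))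
      rw [Finsupp.add_apply, h1, Finsupp.finsetSum_apply, zero_add]
      refine Finset.sum_eq_zero fun k hk => ?_
      rw [Finsupp.single_apply, if_neg]
      have := Finset.mem_range.1 hk
      omega
    · intro hm
      obtain ⟨n, rfl⟩ := Nat.exists_eq_add_of_lt hm
      simp only [zero_add, Nat.add_sub_cancel]
      rw [Finsupp.add_apply, Finsupp.finsetSum_apply,
        Finset.sum_eq_single n (fun k _ hk => by simp [hk])
          (fun h => absurd (Finset.mem_range.2 (Nat.lt_succ_self n)) h)]
      simpa [hf1] using hδa n

/-- Reindexing a sequence by `Fin 1 × ℕ`. -/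
theorem isGeneralisedBackwardShift_one_of_sequence {B : X →L[ℂ] X} {e : ℕ → X}
    (hli : LinearIndependent ℂ e) (hd : Dense (Submodule.span ℂ (range e) : Set X))
    (hB : ∀ m, ∃ c : ℕ →₀ ℂ, B (e m) = Finsupp.linearCombination ℂ e c ∧
      (∀ i ∈ c.support, i < m) ∧ (0 < m → c (m - 1) ≠ 0)) :
    IsGeneralisedBackwardShift 1 B := by
  let σ : Fin 1 × ℕ ≃ ℕ := Equiv.uniqueProd ℕ (Fin 1)
  refine ⟨e ∘ σ, hli.comp _ σ.injective, by rwa [σ.surjective.range_comp], fun l k => ?_⟩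
  obtain ⟨c, hc, hlt, hne⟩ := hB k
  have hl : l = 0 := Subsingleton.elim _ _
  subst hl
  refine ⟨c.mapDomain σ.symm, ?_, fun i hi => ?_, fun hk => ?_⟩
  · rw [Finsupp.linearCombination_mapDomain]
    have : (e ∘ σ) ∘ σ.symm = e := by ext; simp
    rw [this]
    exact hc
  · rw [← Finsupp.equivMapDomain_eq_mapDomain, Finsupp.mem_support_iff,
      Finsupp.equivMapDomain_apply, ← Finsupp.mem_support_iff] at hi
    have := hlt _ hi
    obtain ⟨l, j⟩ := i
    have hl : l = 0 := Subsingleton.elim _ _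
    subst hl
    exact Prod.Lex.right _ this
  · rw [← Finsupp.equivMapDomain_eq_mapDomain, Finsupp.equivMapDomain_apply]
    exact hne hk

end NormedSpace

/-! ### Mixing through asymptotic orbit pairs -/

section Mixing

variable {X : Type*} [NormedAddCommGroup X] [NormedSpace ℂ X]

/-- The pairs `(y, z)` for which there are `w k → y` with `R ^ k (w k) → z`. -/
def asymptoticOrbitPairs (R : X →L[ℂ] X) : Submodule ℂ (X × X) where
  carrier := {p | ∃ w : ℕ → X, Tendsto w atTop (𝓝 p.1) ∧
    Tendsto (fun k => (R ^ k) (w k)) atTop (𝓝 p.2)}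
  add_mem' := by
    rintro p q ⟨w, h1, h2⟩ ⟨w', h1', h2'⟩
    exact ⟨fun k => w k + w' k, h1.add h1', by simpa using h2.add h2'⟩
  zero_mem' := ⟨fun _ => 0, tendsto_const_nhds, by simp⟩
  smul_mem' := by
    rintro c p ⟨w, h1, h2⟩
    exact ⟨fun k => c • w k, h1.const_smul c, by simpa using h2.const_smul c⟩

theorem mem_asymptoticOrbitPairs {R : X →L[ℂ] X} {p : X × X} :
    p ∈ asymptoticOrbitPairs R ↔ ∃ w : ℕ → X, Tendsto w atTop (𝓝 p.1) ∧
      Tendsto (fun k => (R ^ k) (w k)) atTop (𝓝 p.2) := Iff.rfl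

/-- The pairs form a subspace, so `(y, 0) + (0, z)` is again a pair; its sequence serves every large
exponent at once. -/
theorem isMixingOperator_of_dense_asymptoticOrbitPairs {R : X →L[ℂ] X} {D : Submodule ℂ X}
    (hD : Dense (D : Set X)) (h1 : ∀ x ∈ D, (x, 0) ∈ asymptoticOrbitPairs R)
    (h2 : ∀ x ∈ D, (0, x) ∈ asymptoticOrbitPairs R) : IsMixingOperator R := by
  intro U V hU hV hUn hVn
  obtain ⟨y, hy, hyU⟩ := hD.exists_mem_open hU hUn
  obtain ⟨z, hz, hzV⟩ := hD.exists_mem_open hV hVn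
  have hyz : (y, z) ∈ asymptoticOrbitPairs R := by
    simpa using add_mem (h1 y hy) (h2 z hz)
  obtain ⟨w, hw1, hw2⟩ := mem_asymptoticOrbitPairs.1 hyz
  obtain ⟨N, hN⟩ := eventually_atTop.1
    ((hw1.eventually (hU.mem_nhds hyU)).and (hw2.eventually (hV.mem_nhds hzV)))
  exact ⟨N, fun n hn => ⟨_, ⟨w n, (hN n hn.le).1, rfl⟩, (hN n hn.le).2⟩⟩

/-- Rotations do not affect the pairs with a zero entry. -/
theorem mem_asymptoticOrbitPairs_smul {R : X →L[ℂ] X} {z : ℂ} (hz : ‖z‖ = 1) {x : X}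
    (h1 : (x, 0) ∈ asymptoticOrbitPairs R) (h2 : (0, x) ∈ asymptoticOrbitPairs R) :
    (x, 0) ∈ asymptoticOrbitPairs (z • R) ∧ (0, x) ∈ asymptoticOrbitPairs (z • R) := by
  have hz0 : z ≠ 0 := by rintro rfl; simp at hz
  constructor
  · obtain ⟨w, hw1, hw2⟩ := mem_asymptoticOrbitPairs.1 h1
    refine mem_asymptoticOrbitPairs.2 ⟨w, hw1, ?_⟩
    refine squeeze_zero_norm (fun k => ?_) (tendsto_zero_iff_norm_tendsto_zero.1 hw2)
    rw [smul_pow, smul_apply, norm_smul, norm_pow, hz, one_pow, one_mul]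
  · obtain ⟨w, hw1, hw2⟩ := mem_asymptoticOrbitPairs.1 h2
    refine mem_asymptoticOrbitPairs.2 ⟨fun k => (z ^ k)⁻¹ • w k, ?_, ?_⟩
    · refine squeeze_zero_norm (fun k => ?_) (tendsto_zero_iff_norm_tendsto_zero.1 hw1)
      simp [norm_smul, hz]
    · refine hw2.congr fun k => ?_
      rw [smul_pow, smul_apply, map_smul, smul_inv_smul₀ (pow_ne_zero _ hz0)]

/-! ### Newton vectors and polynomial interpolation -/

/-- The Newton expansion at `t` of a function, evaluated along the nilpotent orbit of `u`. -/
noncomputable def newtonVector (T : X →L[ℂ] X) (u : X) (N : ℕ) (f : ℂ → ℂ) (t : ℂ) : X :=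
  ∑ i ∈ Finset.range N, ((fwdDiff 1)^[i] f t) • (T ^ (N - 1 - i)) u

theorem one_add_apply_newtonVector {T : X →L[ℂ] X} {u : X} {N : ℕ} (hu : (T ^ N) u = 0)
    {f : ℂ → ℂ} (hf : (fwdDiff 1)^[N] f = 0) (t : ℂ) :
    (1 + T) (newtonVector T u N f t) = newtonVector T u N f (t + 1) := by
  have hΔ : ∀ i, (fwdDiff 1)^[i] f (t + 1) = (fwdDiff 1)^[i] f t + (fwdDiff 1)^[i + 1] f t := by
    intro i
    rw [Function.iterate_succ_apply', fwdDiff]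
    ring
  have hT : T (newtonVector T u N f t) =
      ∑ i ∈ Finset.range N, ((fwdDiff 1)^[i + 1] f t) • (T ^ (N - 1 - i)) u := by
    have hTi : ∀ i ∈ Finset.range N, T (((fwdDiff 1)^[i] f t) • (T ^ (N - 1 - i)) u) =
        ((fwdDiff 1)^[i] f t) • (T ^ (N - i)) u := by
      intro i hi
      have : N - i = N - 1 - i + 1 := by have := Finset.mem_range.1 hi; omega
      rw [map_smul, this, pow_succ']
      rfl
    rw [newtonVector, map_sum, Finset.sum_congr rfl hTi]
    -- The same sum over `N + 1` indices is split at either end: the last term vanishes by `hf`, the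
    -- first by `hu`.
    have h1 := Finset.sum_range_succ (fun i => ((fwdDiff 1)^[i] f t) • (T ^ (N - i)) u) N
    have h2 := Finset.sum_range_succ' (fun i => ((fwdDiff 1)^[i] f t) • (T ^ (N - i)) u) N
    rw [h1, hf] at h2
    simpa [hu, Nat.sub_sub, add_comm] using h2
  rw [add_apply, hT]
  simp only [newtonVector, hΔ, add_smul, Finset.sum_add_distrib]
  rfl

theorem one_add_pow_apply_newtonVector {T : X →L[ℂ] X} {u : X} {N : ℕ} (hu : (T ^ N) u = 0)
    {f : ℂ → ℂ} (hf : (fwdDiff 1)^[N] f = 0) (k : ℕ) :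
    ((1 + T) ^ k) (newtonVector T u N f 0) = newtonVector T u N f k := by
  induction k with
  | zero => simp
  | succ k ih =>
    rw [pow_succ', mul_apply_eq_comp, ih, one_add_apply_newtonVector hu hf]
    simp

/-- Pointwise convergence on a half-line of integers gives convergence of Newton vectors. -/
theorem tendsto_newtonVector (T : X →L[ℂ] X) (u : X) (N : ℕ) {f : ℕ → ℂ → ℂ} {g : ℂ → ℂ}
    {t : ℕ → ℂ} (h : ∀ j : ℕ, Tendsto (fun k => f k (t k + j)) atTop (𝓝 (g j))) :
    Tendsto (fun k => newtonVector T u N (f k) (t k)) atTop (𝓝 (newtonVector T u N g 0)) := by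
  refine tendsto_finsetSum _ fun i _ => Tendsto.smul_const ?_ _
  -- The `i`-th difference at `t` is a fixed combination of the values at `t, …, t + i`.
  simp only [fwdDiff_iter_eq_sum_shift]
  refine tendsto_finsetSum _ fun j _ => ?_
  simpa using (h j).const_smul (((-1 : ℤ) ^ (i - j) * i.choose j))

theorem newtonVector_zero (T : X →L[ℂ] X) (u : X) (N : ℕ) (t : ℂ) :
    newtonVector T u N 0 t = 0 := by
  refine Finset.sum_eq_zero fun i _ => ?_
  simp [fwdDiff_iter_eq_sum_shift]

theorem Polynomial.tendsto_eval_affine_div_pow {q : Polynomial ℂ} {n : ℕ} (hq : q.natDegree < n)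
    (a b : ℂ) : Tendsto (fun k : ℕ => q.eval (a * k + b) / (k : ℂ) ^ n) atTop (𝓝 0) := by
  have hinv : Tendsto (fun k : ℕ => ((k : ℂ))⁻¹) atTop (𝓝 0) :=
    tendsto_inv_atTop_nhds_zero_nat (𝕜 := ℂ)
  have hlin : Tendsto (fun k : ℕ => a + b * (k : ℂ)⁻¹) atTop (𝓝 a) := by
    simpa using (hinv.const_mul b).const_add a
  have hterm : ∀ j ∈ Finset.range n, Tendsto
      (fun k : ℕ => q.coeff j * ((a + b * (k : ℂ)⁻¹) ^ j * ((k : ℂ)⁻¹) ^ (n - j))) atTop (𝓝 0) := by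
    intro j hj
    have hnj : n - j ≠ 0 := by have := Finset.mem_range.1 hj; omega
    simpa [hnj] using ((hlin.pow j).mul (hinv.pow (n - j))).const_mul (q.coeff j)
  have hs := tendsto_finsetSum _ hterm
  rw [Finset.sum_const_zero] at hs
  refine hs.congr' ?_
  filter_upwards [eventually_ne_atTop 0] with k hk
  have hk' : (k : ℂ) ≠ 0 := Nat.cast_ne_zero.2 hk
  rw [Polynomial.eval_eq_sum_range' hq, Finset.sum_div]
  refine Finset.sum_congr rfl fun j hj => ?_
  have hjn : j ≤ n := (Finset.mem_range.1 hj).le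
  have h1 : a * k + b = (a + b * (k : ℂ)⁻¹) * k := by field_simp
  rw [h1, mul_pow, inv_pow, mul_div_assoc, mul_div_assoc]
  congr 2
  rw [eq_div_iff (pow_ne_zero _ hk'), ← Nat.sub_add_cancel hjn, pow_add]
  simp only [Nat.add_sub_cancel]
  rw [inv_mul_cancel_left₀ (pow_ne_zero _ hk')]

theorem newtonVector_mem_asymptoticOrbitPairs {T : X →L[ℂ] X} {u : X} {n : ℕ}
    (hu : (T ^ (2 * n)) u = 0) {q : Polynomial ℂ} (hq : q.natDegree < n) :
    (newtonVector T u (2 * n) q.eval 0, 0) ∈ asymptoticOrbitPairs (1 + T) ∧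
    (0, newtonVector T u (2 * n) q.eval 0) ∈ asymptoticOrbitPairs (1 + T) := by
  have hinv : Tendsto (fun k : ℕ => ((k : ℂ))⁻¹) atTop (𝓝 0) :=
    tendsto_inv_atTop_nhds_zero_nat (𝕜 := ℂ)
  constructor
  -- `q(x)(1 - x/k)^n` tends to `q` at fixed `j`; at `k + j` it is `q(k + j)(-j/k)^n`, which tends
  -- to 0 as `deg q < n`.
  · set p : ℕ → Polynomial ℂ := fun k => q * (1 - Polynomial.C ((k : ℂ)⁻¹) * Polynomial.X) ^ n with hp
    have hdeg : ∀ k, (p k).natDegree < 2 * n := by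
      intro k
      have : (p k).natDegree ≤ q.natDegree + n * 1 := by
        refine Polynomial.natDegree_mul_le_of_le le_rfl (Polynomial.natDegree_pow_le_of_le n ?_)
        compute_degree
      omega
    refine mem_asymptoticOrbitPairs.2 ⟨fun k => newtonVector T u (2 * n) (p k).eval 0, ?_, ?_⟩
    · refine tendsto_newtonVector (t := fun _ => 0) T u (2 * n) fun j => ?_
      simpa [hp] using
        ((((hinv.mul_const (j : ℂ)).const_sub 1).pow n).const_mul (q.eval (j : ℂ)))
    · simp only [one_add_pow_apply_newtonVector hu (Polynomial.fwdDiff_iter_eq_zero_of_degree_lt (hdeg _))]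
      rw [← newtonVector_zero T u (2 * n) 0]
      refine tendsto_newtonVector T u (2 * n) fun j => ?_
      have h := (Polynomial.tendsto_eval_affine_div_pow hq 1 j).mul_const ((-(j : ℂ)) ^ n)
      rw [zero_mul] at h
      refine h.congr' ?_
      filter_upwards [eventually_ne_atTop 0] with k hk
      have hk' : (k : ℂ) ≠ 0 := Nat.cast_ne_zero.2 hk
      have h1 : 1 - (k : ℂ)⁻¹ * (k + j) = -j / k := by field_simp; ring
      simp only [hp, Polynomial.eval_mul, Polynomial.eval_pow, Polynomial.eval_sub, Polynomial.eval_one, Polynomial.eval_C, Polynomial.eval_X, h1, div_pow, one_mul]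
      ring
  -- The mirror choice `q(x - k)(x/k)^n` is small near 0 and close to `q(j)` at `k + j`.
  · set p : ℕ → Polynomial ℂ := fun k => q.comp (Polynomial.X - Polynomial.C (k : ℂ)) * (Polynomial.C ((k : ℂ)⁻¹) * Polynomial.X) ^ n with hp
    have hdeg : ∀ k, (p k).natDegree < 2 * n := by
      intro k
      have : (p k).natDegree ≤ q.natDegree + n * 1 := by
        refine Polynomial.natDegree_mul_le_of_le ?_ (Polynomial.natDegree_pow_le_of_le n ?_)
        · rw [Polynomial.natDegree_comp, Polynomial.natDegree_X_sub_C, mul_one]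
        · compute_degree
      omega
    refine mem_asymptoticOrbitPairs.2 ⟨fun k => newtonVector T u (2 * n) (p k).eval 0, ?_, ?_⟩
    · dsimp only
      conv => enter [3, 1]; rw [← newtonVector_zero T u (2 * n) 0]
      refine tendsto_newtonVector (t := fun _ => 0) T u (2 * n) fun j => ?_
      have h := (Polynomial.tendsto_eval_affine_div_pow hq (-1) j).mul_const ((j : ℂ) ^ n)
      rw [zero_mul] at h
      refine h.congr fun k => ?_
      have h1 : -1 * (k : ℂ) + j = j - k := by ring
      simp only [hp, Polynomial.eval_mul, Polynomial.eval_pow, Polynomial.eval_sub, Polynomial.eval_comp, Polynomial.eval_C, Polynomial.eval_X, h1, zero_add, mul_pow,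
        inv_pow]
      ring
    · simp only [one_add_pow_apply_newtonVector hu (Polynomial.fwdDiff_iter_eq_zero_of_degree_lt (hdeg _))]
      refine tendsto_newtonVector T u (2 * n) fun j => ?_
      have h : Tendsto (fun k : ℕ => q.eval (j : ℂ) * (1 + j * (k : ℂ)⁻¹) ^ n) atTop
          (𝓝 (q.eval (j : ℂ))) := by
        simpa using ((((hinv.const_mul (j : ℂ)).const_add 1).pow n).const_mul (q.eval (j : ℂ)))
      refine h.congr' ?_
      filter_upwards [eventually_ne_atTop 0] with k hk
      have hk' : (k : ℂ) ≠ 0 := Nat.cast_ne_zero.2 hk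
      have h1 : (k : ℂ)⁻¹ * (k + j) = 1 + j * (k : ℂ)⁻¹ := by field_simp
      simp only [hp, Polynomial.eval_mul, Polynomial.eval_pow, Polynomial.eval_sub, Polynomial.eval_comp, Polynomial.eval_C, Polynomial.eval_X, h1,
        add_sub_cancel_left]

/-- The binomial polynomial `t ↦ t.choose m`. -/
theorem exists_polynomial_eval_eq_choose (m : ℕ) :
    ∃ q : Polynomial ℂ, q.natDegree ≤ m ∧ ∀ k : ℕ, q.eval (k : ℂ) = (k.choose m : ℂ) := by
  refine ⟨Polynomial.C ((m.factorial : ℂ)⁻¹) * descPochhammer ℂ m, ?_, fun k => ?_⟩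
  · exact (Polynomial.natDegree_C_mul_le _ _).trans (descPochhammer_natDegree ℂ m).le
  · have : (m.factorial : ℂ) ≠ 0 := Nat.cast_ne_zero.2 m.factorial_ne_zero
    rw [Polynomial.eval_mul, Polynomial.eval_C, descPochhammer_eval_eq_descFactorial,
      Nat.descFactorial_eq_factorial_mul_choose, Nat.cast_mul, inv_mul_cancel_left₀ this]

theorem fwdDiff_iter_zero_of_eval_eq_choose {q : Polynomial ℂ} {m : ℕ}
    (hq : ∀ k : ℕ, q.eval (k : ℂ) = (k.choose m : ℂ)) (i : ℕ) :
    (fwdDiff 1)^[i] q.eval 0 = if i = m then 1 else 0 := by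
  have h := congrArg (Int.cast : ℤ → ℂ) (fwdDiff_iter_choose_zero m i)
  rw [fwdDiff_iter_eq_sum_shift] at h ⊢
  simpa [hq, zsmul_eq_mul] using h

/-- If `T ^ (2 * n)` kills `u`, the vector `T ^ n u` can be sent to `0`, and reached from `0`,
by high powers of `1 + T`. -/
theorem pow_apply_mem_asymptoticOrbitPairs {T : X →L[ℂ] X} {u : X} {n : ℕ} (hn : 0 < n)
    (hu : (T ^ (2 * n)) u = 0) :
    ((T ^ n) u, 0) ∈ asymptoticOrbitPairs (1 + T) ∧
    (0, (T ^ n) u) ∈ asymptoticOrbitPairs (1 + T) := by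
  obtain ⟨q, hdeg, hq⟩ := exists_polynomial_eval_eq_choose (n - 1)
  have h : newtonVector T u (2 * n) q.eval 0 = (T ^ n) u := by
    rw [newtonVector, Finset.sum_eq_single (n - 1)]
    · rw [fwdDiff_iter_zero_of_eval_eq_choose hq, if_pos rfl, one_smul]
      congr 2
      omega
    · intro i _ hi
      rw [fwdDiff_iter_zero_of_eval_eq_choose hq, if_neg hi, zero_smul]
    · intro h
      exact absurd (Finset.mem_range.2 (by omega)) h
  simpa only [h] using newtonVector_mem_asymptoticOrbitPairs hu (lt_of_le_of_lt hdeg (by omega))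

/-! ### Mixing perturbations and the conclusion -/

/-- Unimodular multiples of the identity perturbed by a backward shift are mixing. -/
theorem isMixingOperator_smul_id_add {B : X →L[ℂ] X} {e : ℕ → X}
    (hd : Dense (Submodule.span ℂ (range e) : Set X))
    (hB : ∀ m, ∃ c : ℕ →₀ ℂ, B (e m) = Finsupp.linearCombination ℂ e c ∧
      (∀ i ∈ c.support, i < m) ∧ (0 < m → c (m - 1) ≠ 0))
    {z : ℂ} (hz : ‖z‖ = 1) : IsMixingOperator (z • ContinuousLinearMap.id ℂ X + B) := by
  have hz0 : z ≠ 0 := by rintro rfl; simp at hz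
  set E : ℕ → Submodule ℂ X := fun n => Submodule.span ℂ (e '' Iio n) with hE
  have hEmono : Monotone E := fun m n h => Submodule.span_mono (image_mono (Iio_subset_Iio h))
  have heE : ∀ {m n}, m < n → e m ∈ E n := fun {m n} h => Submodule.subset_span ⟨m, h, rfl⟩
  have hBe : ∀ m, B (e m) ∈ E m := by
    intro m
    obtain ⟨c, hc, hlt, -⟩ := hB m
    exact (Finsupp.mem_span_image_iff_linearCombination ℂ).2
      ⟨c, (Finsupp.mem_supported ℂ c).2 hlt, hc.symm⟩
  have hker : ∀ n, ∀ x ∈ E n, (B ^ n) x = 0 := by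
    intro n
    induction n with
    | zero => intro x hx; simpa [hE] using hx
    | succ n ih =>
      have hle : E (n + 1) ≤ (E n).comap (B : X →ₗ[ℂ] X) := by
        refine Submodule.span_le.2 ?_
        rintro _ ⟨i, hi, rfl⟩
        exact hEmono (Nat.lt_succ_iff.1 hi) (hBe i)
      intro x hx
      rw [pow_succ]
      exact ih _ (hle hx)
  -- `B (e (m + 1))` is a nonzero multiple of `e m` plus lower terms, which already have preimages
  -- by induction.
  have hpre : ∀ m, ∃ y ∈ E (m + 2), B y = e m := by
    intro m
    induction m using Nat.strong_induction_on with
    | _ m ih =>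
      obtain ⟨c, hc, hlt, hne⟩ := hB (m + 1)
      have hcm : c m ≠ 0 := hne (Nat.succ_pos m)
      have hEm : E m ≤ (E (m + 1)).map (B : X →ₗ[ℂ] X) := by
        refine Submodule.span_le.2 ?_
        rintro _ ⟨i, hi, rfl⟩
        obtain ⟨y, hy, hy'⟩ := ih i hi
        exact ⟨y, hEmono (by have : i < m := hi; omega) hy, hy'⟩
      have hlow : Finsupp.linearCombination ℂ e (c.erase m) ∈ E m := by
        refine (Finsupp.mem_span_image_iff_linearCombination ℂ).2 ⟨_, ?_, rfl⟩
        refine (Finsupp.mem_supported ℂ _).2 fun i hi => ?_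
        rw [Finsupp.support_erase, Finset.coe_erase] at hi
        have h1 := hlt i hi.1
        have h2 : i ≠ m := hi.2
        exact lt_of_le_of_ne (Nat.lt_succ_iff.1 h1) h2
      obtain ⟨y, hy, hy'⟩ := hEm hlow
      have hy'' : B y = Finsupp.linearCombination ℂ e (c.erase m) := hy'
      refine ⟨(c m)⁻¹ • (e (m + 1) - y), Submodule.smul_mem _ _ (sub_mem (heE (by omega))
        (hEmono (by omega) hy)), ?_⟩
      rw [map_smul, map_sub, hc, hy'']
      conv_lhs => rw [← Finsupp.single_add_erase m c]
      simp [hcm]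
  have hsurj : ∀ n, E n ≤ (E (n + 1)).map (B : X →ₗ[ℂ] X) := by
    intro n
    refine Submodule.span_le.2 ?_
    rintro _ ⟨i, hi, rfl⟩
    obtain ⟨y, hy, hy'⟩ := hpre i
    exact ⟨y, hEmono (by have : i < n := hi; omega) hy, hy'⟩
  have hpow : ∀ j n, ∀ x ∈ E n, ∃ u ∈ E (n + j), (B ^ j) u = x := by
    intro j
    induction j with
    | zero => exact fun n x hx => ⟨x, hx, by simp⟩
    | succ j ih =>
      intro n x hx
      obtain ⟨y, hy, rfl⟩ := ih n x hx
      obtain ⟨u, hu, rfl⟩ := hsurj _ hy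
      exact ⟨u, hu, by rw [pow_succ]; rfl⟩
  have hR : z • ContinuousLinearMap.id ℂ X + B = z • (1 + z⁻¹ • B) := by
    rw [smul_add, smul_inv_smul₀ hz0]
    rfl
  have hmem : ∀ m, (e m, 0) ∈ asymptoticOrbitPairs (z • ContinuousLinearMap.id ℂ X + B) ∧
      (0, e m) ∈ asymptoticOrbitPairs (z • ContinuousLinearMap.id ℂ X + B) := by
    intro m
    -- Lifting `m + 1` times from `E (m + 1)` lands in `E (2 * (m + 1))`, which `B ^ (2 * (m + 1))`
    -- kills: hence `n = m + 1`.
    obtain ⟨u, hu, hum⟩ := hpow (m + 1) (m + 1) (e m) (heE (Nat.lt_succ_self m))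
    have hzpow : ∀ j (x : X), ((z⁻¹ • B) ^ j) x = (z⁻¹) ^ j • (B ^ j) x := by
      intro j x
      rw [smul_pow]
      rfl
    have h := pow_apply_mem_asymptoticOrbitPairs (T := z⁻¹ • B) (u := z ^ (m + 1) • u)
      (Nat.succ_pos m) (by
        rw [hzpow, map_smul, hker _ _ (by rwa [two_mul]), smul_zero, smul_zero])
    rw [hzpow, map_smul, hum, inv_pow, inv_smul_smul₀ (pow_ne_zero _ hz0)] at h
    rw [hR]
    exact mem_asymptoticOrbitPairs_smul hz h.1 h.2
  refine isMixingOperator_of_dense_asymptoticOrbitPairs hd (fun x hx => ?_) (fun x hx => ?_)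
  · have hle : Submodule.span ℂ (range e) ≤ (asymptoticOrbitPairs
        (z • ContinuousLinearMap.id ℂ X + B)).comap (LinearMap.inl ℂ X X) := by
      refine Submodule.span_le.2 ?_
      rintro _ ⟨m, rfl⟩
      exact (hmem m).1
    exact hle hx
  · have hle : Submodule.span ℂ (range e) ≤ (asymptoticOrbitPairs
        (z • ContinuousLinearMap.id ℂ X + B)).comap (LinearMap.inr ℂ X X) := by
      refine Submodule.span_le.2 ?_
      rintro _ ⟨m, rfl⟩
      exact (hmem m).2
    exact hle hx

end Mixing

theorem theorem3p1 {X : Type*} [NormedAddCommGroup X] [NormedSpace ℂ X] [CompleteSpace X]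
    [TopologicalSpace.SeparableSpace X] (hX : ¬ FiniteDimensional ℂ X)
    (S : X →L[ℂ] X) (hS : Dense (generalisedKernel S)) :
    S ∈ closure {B : X →L[ℂ] X | IsGeneralisedBackwardShift 1 B} ∧
    ∀ z : ℂ, ‖z‖ = 1 →
      z • ContinuousLinearMap.id ℂ X + S ∈ closure {T : X →L[ℂ] X | IsMixingOperator T} := by
  obtain ⟨e, hli, hd, hSe⟩ := exists_triangular_of_dense_generalisedKernel hX S hS
  refine ⟨Metric.mem_closure_iff.2 fun ε hε => ?_, fun z hz =>
    Metric.mem_closure_iff.2 fun ε hε => ?_⟩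
  · obtain ⟨B, hSB, hB⟩ := exists_near_shift_of_triangular S hli hSe hε
    exact ⟨B, isGeneralisedBackwardShift_one_of_sequence hli hd hB, hSB⟩
  · obtain ⟨B, hSB, hB⟩ := exists_near_shift_of_triangular S hli hSe hε
    exact ⟨_, isMixingOperator_smul_id_add hd hB hz, by rwa [dist_add_left]⟩
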